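/- Let $\mathcal{O}$ be a residually finite Dedekind domain, i.e. a Dedekind domain such that $\mathcal{O}/\mathfrak{a}$ is finite for every nonzero ideal $\mathfrak{a}$, and let $N(\mathfrak{a})=|\mathcal{O}/\mathfrak{a}|$. (Every ring $R$ below is such a domain.) Let $I(R)$ be the set of nonzero ideals of $R$. For a finite family $\mathcal{A}=(c_1,\dots,c_n)$ of vectors in $R^{\ell}$ and $\mathfrak{a}\in I(R)$ put $H_{j,\mathfrak{a}}=\{[x]\in(R/\mathfrak{a})^{\ell} : x c_j\equiv 0 \bmod \mathfrak{a}\}$ and $$\chi^{\mathrm{quasi}}_{\mathcal{A}}(\mathfrak{a})=\Bigl|(R/\mathfrak{a})^{\ell}\setminus\bigcup_{j=1}^n H_{j,\mathfrak{a}}\Bigr| .$$ For $J\subseteq\{1,\dots,n\}$ let $\phi_J\colon R^{\ell}\to R^{J}$, $x\mapsto (x c_j)_{j\in J}$, let $r(J)$ be the rank of its image, and let $\mathfrak{d}_{J,1}\mid\cdots\mid\mathfrak{d}_{J,r(J)}$ be the nonzero ideals, unique by the structure theorem for finitely generated modules over a Dedekind domain, such that the torsion submodule of $\operatorname{coker}\phi_J$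 is isomorphic to $\bigoplus_{i=1}^{r(J)}R/\mathfrak{d}_{J,i}$ (unit ideals are allowed). The LCM-period is $\rho_{\mathcal{A}}=\operatorname{lcm}\{\mathfrak{d}_{J,r(J)} : \varnothing\ne J\subseteq\{1,\dots,n\}\}$, where $\mathfrak{d}_{J,r(J)}$ is read as the unit ideal if $r(J)=0$. For $\kappa\mid\rho_{\mathcal{A}}$ put $$f^{\kappa}_{\mathcal{A}}(t)=\sum_{J\subseteq\{1,\dots,n\}}(-1)^{|J|}\Bigl(\prod_{i=1}^{r(J)}N(\kappa+\mathfrak{d}_{J,i})\Bigr)t^{\ell-r(J)}\in\mathbb{Z}[t].$$ A polynomial $f\in\mathbb{Z}[t]$ is a $\kappa$-constituent of $\phi\colon I(R)\to\mathbb{Z}$ associated with $\rho\in I(R)$ if $\phi(\mathfrak{a})=f(N(\mathfrak{a}))$ for every $\mathfrak{a}\in I(R)$ with $\mathfrak{a}+\rho=\kappa$. **Theorem.** Let $\mathcal{A}=(c_1,\dots,c_n)$ be a finite family in $\mathcal{O}^{\ell}$, let $S\subseteq\mathcal{O}$ be a multiplicative subset with $0\notin S$, let $\mathcal{O}_S$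 be the localization of $\mathcal{O}$ at $S$ (again a residually finite Dedekind domain), and let $\mathcal{A}_S$ be $\mathcal{A}$ considered in $\mathcal{O}_S^{\ell}$. For an ideal $\mathfrak{A}$ of $\mathcal{O}_S$ write $\mathfrak{A}\cap\mathcal{O}$ for its preimage in $\mathcal{O}$. 1. $\rho_{\mathcal{A}_S}=\rho_{\mathcal{A}}\mathcal{O}_S$. 2. For every $\mathfrak{A}\in I(\mathcal{O}_S)$, $\chi^{\mathrm{quasi}}_{\mathcal{A}_S}(\mathfrak{A})=\chi^{\mathrm{quasi}}_{\mathcal{A}}(\mathfrak{A}\cap\mathcal{O})$. 3. For every $\delta\mid\rho_{\mathcal{A}_S}$, the polynomial $f^{\delta\cap\mathcal{O}}_{\mathcal{A}}$ is a $(\delta\cap\mathcal{O})$-constituent of $\chi^{\mathrm{quasi}}_{\mathcal{A}}$ associated with $\rho_{\mathcal{A}}$, the polynomial $f^{\delta}_{\mathcal{A}_S}$ is a $\delta$-constituent of $\chi^{\mathrm{quasi}}_{\mathcal{A}_S}$ associated with $\rho_{\mathcal{A}_S}$, and $f^{\delta}_{\mathcal{A}_S}(t)=f^{\delta\cap\mathcal{O}}_{\mathcal{A}}(t)$.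 -/

import Mathlib

open Polynomial

namespace ReducedArrangement

noncomputable section

/-- The absolute norm `N(𝔞) = |R/𝔞|` of an ideal. -/
def idealNorm {R : Type*} [CommRing R] (𝔞 : Ideal R) : ℕ := Nat.card (R ⧸ 𝔞)

/-- `f` is a `κ`-constituent, associated with `ρ`, of the function `φ` on nonzero ideals:
`φ(𝔞) = f(N(𝔞))` for every nonzero ideal `𝔞` with `𝔞 + ρ = κ`. -/
def IsConstituent {R : Type*} [CommRing R] (φ : Ideal R → ℤ) (ρ κ : Ideal R) (f : ℤ[X]) : Prop :=
  ∀ 𝔞 : Ideal R, 𝔞 ≠ ⊥ → 𝔞 ⊔ ρ = κ → φ 𝔞 = f.eval (idealNorm 𝔞 : ℤ)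

/-- The `𝔞`-reduced hyperplane `H_{v,𝔞} ⊆ (R/𝔞)^ℓ` of a vector `v ∈ R^ℓ`. -/
def reducedHyperplane {R : Type*} [CommRing R] {ℓ : ℕ} (v : Fin ℓ → R) (𝔞 : Ideal R) :
    Set (Fin ℓ → R ⧸ 𝔞) :=
  {y | ∃ x : Fin ℓ → R, (∀ i, Ideal.Quotient.mk 𝔞 (x i) = y i) ∧ x ⬝ᵥ v ∈ 𝔞}

/-- The complement `M(𝒜(R/𝔞))` of the `𝔞`-reduced arrangement of `𝒜 = (c_1, …, c_n)`. -/
def complement {R : Type*} [CommRing R] {n ℓ : ℕ} (c : Fin n → Fin ℓ → R) (𝔞 : Ideal R) :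
    Set (Fin ℓ → R ⧸ 𝔞) :=
  (⋃ j, reducedHyperplane (c j) 𝔞)ᶜ

/-- The characteristic quasi-polynomial `χ_𝒜(𝔞) = |M(𝒜(R/𝔞))|`. -/
def charQuasi {R : Type*} [CommRing R] {n ℓ : ℕ} (c : Fin n → Fin ℓ → R) (𝔞 : Ideal R) : ℤ :=
  ((complement c 𝔞).ncard : ℤ)

/-- The map `φ_J : R^ℓ → R^J`, `x ↦ x C_J`, where `C_J` is the matrix with columns `c_j`, `j ∈ J`. -/
def phi {R : Type*} [CommRing R] {n ℓ : ℕ} (c : Fin n → Fin ℓ → R) (J : Finset (Fin n)) :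
    (Fin ℓ → R) →ₗ[R] (J → R) :=
  Matrix.vecMulLinear (Matrix.of fun (i : Fin ℓ) (j : J) => c j i)

/-- The rank `r(J)` of the image of `φ_J`. -/
def rk {R : Type*} [CommRing R] {n ℓ : ℕ} (c : Fin n → Fin ℓ → R) (J : Finset (Fin n)) : ℕ :=
  Module.finrank R (LinearMap.range (phi c J))

/-- The cokernel of `φ_J`. -/
abbrev Coker {R : Type*} [CommRing R] {n ℓ : ℕ} (c : Fin n → Fin ℓ → R) (J : Finset (Fin n)) :
    Type _ :=
  (J → R) ⧸ LinearMap.range (phi c J)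

/-- `d_1 ∣ d_2 ∣ ⋯ ∣ d_r` are the invariant ideals of the module `M`: nonzero ideals, each dividing
the next, such that the torsion submodule of `M` is isomorphic to `R/d_1 ⊕ ⋯ ⊕ R/d_r`. (For a
finitely generated module over a Dedekind domain the torsion-free part of `M` is a direct summand,
so this is the torsion part of the structure theorem. Unit ideals `d_i` are allowed.) -/
def IsInvariantIdeals {R : Type*} [CommRing R] (M : Type*) [AddCommGroup M] [Module R M] {r : ℕ}
    (d : Fin r → Ideal R) : Prop :=
  (∀ i, d i ≠ ⊥) ∧ (∀ i j, i ≤ j → d i ∣ d j) ∧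
    Nonempty (Submodule.torsion R M ≃ₗ[R] ((i : Fin r) → R ⧸ d i))

open Classical in
/-- The invariant ideals `d_{J,1} ∣ ⋯ ∣ d_{J,r(J)}` of the cokernel of `φ_J`. Over a Dedekind
domain they exist and are unique, by the structure theorem for finitely generated modules. -/
def invariantIdeal {R : Type*} [CommRing R] {n ℓ : ℕ} (c : Fin n → Fin ℓ → R)
    (J : Finset (Fin n)) : Fin (rk c J) → Ideal R :=
  if h : ∃ d : Fin (rk c J) → Ideal R, IsInvariantIdeals (Coker c J) d then h.choose
  else fun _ => ⊤

/-- The last invariant ideal `d_{J,r(J)}`; the unit ideal if `r(J) = 0`. -/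
def lastInvariantIdeal {R : Type*} [CommRing R] {n ℓ : ℕ} (c : Fin n → Fin ℓ → R)
    (J : Finset (Fin n)) : Ideal R :=
  if h : 0 < rk c J then invariantIdeal c J ⟨rk c J - 1, Nat.sub_lt h Nat.one_pos⟩ else ⊤

/-- The LCM-period `ρ_𝒜`: the least common multiple, that is, the intersection, of the ideals
`d_{J,r(J)}` over all nonempty `J`. -/
def lcmPeriod {R : Type*} [CommRing R] {n ℓ : ℕ} (c : Fin n → Fin ℓ → R) : Ideal R :=
  ⨅ (J : Finset (Fin n)) (_ : J.Nonempty), lastInvariantIdeal c J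

/-- The number `m(J, κ) = ∏_{i=1}^{r(J)} N(κ + d_{J,i})`; it is `1` for `J = ∅`, where `r(J) = 0`. -/
def multiplicity {R : Type*} [CommRing R] {n ℓ : ℕ} (c : Fin n → Fin ℓ → R)
    (J : Finset (Fin n)) (κ : Ideal R) : ℕ :=
  ∏ i : Fin (rk c J), idealNorm (κ ⊔ invariantIdeal c J i)

/-- The `κ`-constituent `f_𝒜^κ(t) = ∑_J (-1)^{|J|} m(J, κ) t^{ℓ - r(J)}`. -/
def constituent {R : Type*} [CommRing R] {n ℓ : ℕ} (c : Fin n → Fin ℓ → R) (κ : Ideal R) : ℤ[X] :=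
  ∑ J : Finset (Fin n), C ((-1) ^ J.card * (multiplicity c J κ : ℤ)) * X ^ (ℓ - rk c J)

/-- The family `𝒜` viewed over an `R`-algebra `R'`. -/
def baseChange {R : Type*} [CommRing R] (R' : Type*) [CommRing R'] [Algebra R R'] {n ℓ : ℕ}
    (c : Fin n → Fin ℓ → R) : Fin n → Fin ℓ → R' :=
  fun j i => algebraMap R R' (c j i)

end

end ReducedArrangement

/-! Everything reduces to counting solutions of linear systems modulo ideals. Tensoring the
presentation of `Coker c J` with `R/𝔞` gives exactly `N(𝔞)^(ℓ - r(J)) ∏ N(𝔞 + d_{J,i})` solutions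
modulo `𝔞` of the system indexed by `J` (`card_ker_lTensor_phi`). Inclusion-exclusion then yields
the constituents, since `ρ ⊆ d_{J,i}` forces `𝔞 + d_{J,i} = (𝔞 + ρ) + d_{J,i}`.

For localization, let `𝔄 ≠ 0`. Each `s ∈ S` acts injectively on the finite ring `O/(𝔄 ∩ O)`, so it
is invertible there and `O/(𝔄 ∩ O) ≅ O_S/𝔄`. Solution counts therefore agree, which is the second
claim. As ranks also agree, `∏ N(𝔄 + D_i) = ∏ N(𝔄 ∩ O + d_i) = ∏ N(𝔄 + d_i O_S)` for all `𝔄`, where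
`D_i` are the invariant ideals over `O_S`. These numbers determine a divisibility chain
(`eq_of_forall_prod_idealNorm_sup`), so `D_i = d_i O_S`, and the period and the constituents follow.

Since `invariantIdeal` is a choice with a default value, existence of a chain of length exactly
`r(J)` must be proved (`exists_isInvariantIdeals`). -/

namespace ReducedArrangement

/-! ### Rearranging sums of cyclic modules into divisibility chains -/

section Chain

variable {R : Type*} [CommRing R]

/-- In a Dedekind domain the colon ideals `(a : b)` and `(b : a)` are comaximal. -/
theorem exists_add_eq_one_mul_mem [IsDedekindDomain R] (a b : Ideal R) :
    ∃ u v : R, u + v = 1 ∧ (∀ y ∈ b, u * y ∈ a) ∧ ∀ x ∈ a, v * x ∈ b := by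
  by_cases h : a ⊔ b = ⊥
  · rw [sup_eq_bot_iff] at h
    exact ⟨1, 0, by simp, by simp [h.1, h.2], by simp⟩
  generalize hg : a ⊔ b = g at h
  have hag : a ≤ g := hg ▸ le_sup_left
  have hbg : b ≤ g := hg ▸ le_sup_right
  obtain ⟨a', ha⟩ := Ideal.dvd_iff_le.2 hag
  obtain ⟨b', hb⟩ := Ideal.dvd_iff_le.2 hbg
  have h1 : a' ⊔ b' = ⊤ := by
    have : g * (a' ⊔ b') = g * 1 := by
      rw [Ideal.mul_sup, ← ha, ← hb, mul_one, hg]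
    exact (mul_left_cancel₀ h this).trans Ideal.one_eq_top
  have h2 : (1 : R) ∈ a' ⊔ b' := (Ideal.eq_top_iff_one _).1 h1
  obtain ⟨u, hu, v, hv, huv⟩ := Submodule.mem_sup.1 h2
  -- With the gcd `g` divided out, `a'` and `b'` are comaximal, and this common product lies in both
  -- `a` and `b`.
  have key : a' * b = b' * a := by
    rw [hb, ha]
    ring
  refine ⟨u, v, huv, fun y hy => ?_, fun x hx => ?_⟩
  · have hmem : u * y ∈ a' * b := Ideal.mul_mem_mul hu hy
    rw [key] at hmem
    exact (Ideal.mul_le_inf hmem).2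
  · have hmem : v * x ∈ b' * a := Ideal.mul_mem_mul hv hx
    rw [← key] at hmem
    exact (Ideal.mul_le_inf hmem).2

/-- The map `R/a → R/b` induced by multiplication by `r`, where `r a ⊆ b`. -/
def quotMul (a b : Ideal R) (r : R) (h : ∀ x ∈ a, r * x ∈ b) : (R ⧸ a) →ₗ[R] R ⧸ b :=
  Submodule.mapQ a b (LinearMap.mulLeft R r) h

/-- For `u + v = 1` with `u b ⊆ a` and `v a ⊆ b`, the maps `(x, y) ↦ (-x + y, v x + u y)` and `(x,
y) ↦ (-u x + y, v x + y)` are well defined on the quotients and mutually inverse. -/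
theorem nonempty_quotient_prod_equiv [IsDedekindDomain R] (a b : Ideal R) :
    Nonempty (((R ⧸ a) × (R ⧸ b)) ≃ₗ[R] (R ⧸ (a ⊔ b)) × (R ⧸ (a ⊓ b))) := by
  obtain ⟨u, v, huv, hu, hv⟩ := exists_add_eq_one_mul_mem a b
  have hu' : ∀ x ∈ a ⊔ b, -u * x ∈ a := fun x hx => by
    obtain ⟨y, hy, z, hz, rfl⟩ := Submodule.mem_sup.1 hx
    rw [neg_mul, mul_add]
    exact neg_mem (add_mem (a.mul_mem_left _ hy) (hu z hz))
  have hv' : ∀ x ∈ a ⊔ b, v * x ∈ b := fun x hx => by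
    obtain ⟨y, hy, z, hz, rfl⟩ := Submodule.mem_sup.1 hx
    rw [mul_add]
    exact add_mem (hv y hy) (b.mul_mem_left _ hz)
  let f : ((R ⧸ a) × (R ⧸ b)) →ₗ[R] (R ⧸ (a ⊔ b)) × (R ⧸ (a ⊓ b)) :=
    ((quotMul a (a ⊔ b) (-1) fun x hx => by
        simpa using (le_sup_left : a ≤ a ⊔ b) hx).coprod
      (quotMul b (a ⊔ b) 1 fun x hx => by
        simpa using (le_sup_right : b ≤ a ⊔ b) hx)).prod
    ((quotMul a (a ⊓ b) v fun x hx => ⟨a.mul_mem_left _ hx, hv x hx⟩).coprod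
      (quotMul b (a ⊓ b) u fun x hx => ⟨hu x hx, b.mul_mem_left _ hx⟩))
  let g : ((R ⧸ (a ⊔ b)) × (R ⧸ (a ⊓ b))) →ₗ[R] (R ⧸ a) × (R ⧸ b) :=
    ((quotMul (a ⊔ b) a (-u) hu').coprod
      (quotMul (a ⊓ b) a 1 fun x hx => by simpa using hx.1)).prod
    ((quotMul (a ⊔ b) b v hv').coprod
      (quotMul (a ⊓ b) b 1 fun x hx => by simpa using hx.2))
  refine ⟨LinearEquiv.ofLinearMap f g ?_ ?_⟩
  · refine LinearMap.ext fun ⟨x, y⟩ => ?_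
    obtain ⟨x, rfl⟩ := Submodule.Quotient.mk_surjective _ x
    obtain ⟨y, rfl⟩ := Submodule.Quotient.mk_surjective _ y
    refine Prod.ext ?_ ?_
    · change Submodule.Quotient.mk (-1 * (-u * x + 1 * y) + 1 * (v * x + 1 * y)) = _
      exact congrArg _ (by linear_combination x * huv)
    · change Submodule.Quotient.mk (v * (-u * x + 1 * y) + u * (v * x + 1 * y)) = _
      exact congrArg _ (by linear_combination y * huv)
  · refine LinearMap.ext fun ⟨x, y⟩ => ?_
    obtain ⟨x, rfl⟩ := Submodule.Quotient.mk_surjective _ x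
    obtain ⟨y, rfl⟩ := Submodule.Quotient.mk_surjective _ y
    refine Prod.ext ?_ ?_
    · change Submodule.Quotient.mk (-u * (-1 * x + 1 * y) + 1 * (v * x + u * y)) = _
      exact congrArg _ (by linear_combination x * huv)
    · change Submodule.Quotient.mk (v * (-1 * x + 1 * y) + 1 * (v * x + u * y)) = _
      exact congrArg _ (by linear_combination y * huv)

/-- A product over `Fin (r + 1)` splits off its first factor. -/
noncomputable def piFinSuccEquiv {r : ℕ} (M : Fin (r + 1) → Type*) [∀ i, AddCommGroup (M i)]
    [∀ i, Module R (M i)] : (∀ i, M i) ≃ₗ[R] M 0 × ∀ i : Fin r, M i.succ where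
  toFun f := (f 0, fun i => f i.succ)
  invFun p := Fin.cons p.1 p.2
  map_add' _ _ := rfl
  map_smul' _ _ := rfl
  left_inv f := Fin.cons_self_tail f
  right_inv p := by ext <;> simp

/-- Replace the pair `a, d 0` by `a ⊔ d 0, a ⊓ d 0`, keep the former as first term, and insert the
latter into the rest of the chain. The clause on common divisors strengthens the induction: it shows
that `a ⊔ d 0` divides every later term. -/
theorem exists_chain_insert [IsDedekindDomain R] {r : ℕ} (a : Ideal R) (d : Fin r → Ideal R)
    (ha : a ≠ ⊥) (hd : ∀ i, d i ≠ ⊥) (hmono : ∀ i j, i ≤ j → d i ∣ d j) :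
    ∃ e : Fin (r + 1) → Ideal R, (∀ i, e i ≠ ⊥) ∧ (∀ i j, i ≤ j → e i ∣ e j) ∧
      (∀ m : Ideal R, m ∣ a → (∀ i, m ∣ d i) → ∀ i, m ∣ e i) ∧
      Nonempty (((R ⧸ a) × ∀ i, R ⧸ d i) ≃ₗ[R] ∀ i, R ⧸ e i) := by
  induction r generalizing a with
  | zero =>
    refine ⟨fun _ => a, fun _ => ha, fun _ _ _ => dvd_rfl, fun m hm _ _ => hm, ?_⟩
    exact ⟨(LinearEquiv.prodUnique (M₂ := ∀ i, R ⧸ d i)).trans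
      (LinearEquiv.funUnique (Fin 1) R (R ⧸ a)).symm⟩
  | succ r ih =>
    have hinf : a ⊓ d 0 ≠ ⊥ := fun h => by
      have := Ideal.mul_le_inf.trans h.le
      rw [le_bot_iff, Ideal.mul_eq_bot] at this
      exact this.elim ha (hd 0)
    obtain ⟨e, he, hchain, hdvd, ⟨φ⟩⟩ := ih (a ⊓ d 0) (fun i => d i.succ) hinf
      (fun i => hd _) (fun i j hij => hmono _ _ (Fin.succ_le_succ_iff.2 hij))
    have hsup : ∀ i, a ⊔ d 0 ∣ e i := hdvd _
      (Ideal.dvd_iff_le.2 (inf_le_left.trans le_sup_left))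
      (fun i => (Ideal.dvd_iff_le.2 le_sup_right).trans (hmono 0 i.succ (Fin.zero_le _)))
    have hsup' : a ⊔ d 0 ≠ ⊥ := fun h => ha (le_bot_iff.1 (le_sup_left.trans_eq h))
    refine ⟨Fin.cons (a ⊔ d 0) e, fun i => ?_, fun i j hij => ?_, fun m hma hmd i => ?_, ?_⟩
    · cases i using Fin.cases with
      | zero => exact hsup'
      | succ i => exact he i
    · cases i using Fin.cases with
      | zero =>
        cases j using Fin.cases with
        | zero => exact dvd_rfl
        | succ j => exact hsup j
      | succ i =>
        cases j using Fin.cases with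
        | zero => exact absurd hij (by simp)
        | succ j => exact hchain i j (Fin.succ_le_succ_iff.1 hij)
    · have hm : m ∣ a ⊔ d 0 :=
        Ideal.dvd_iff_le.2 (sup_le (Ideal.dvd_iff_le.1 hma) (Ideal.dvd_iff_le.1 (hmd 0)))
      cases i using Fin.cases with
      | zero => exact hm
      | succ i => exact hm.trans (hsup i)
    · obtain ⟨ψ⟩ := nonempty_quotient_prod_equiv a (d 0)
      exact ⟨(LinearEquiv.prodCongr (LinearEquiv.refl R (R ⧸ a))
          (piFinSuccEquiv fun i => R ⧸ d i)) ≪≫ₗ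
        (LinearEquiv.prodAssoc R (R ⧸ a) (R ⧸ d 0) (∀ i : Fin r, R ⧸ d i.succ)).symm ≪≫ₗ
        (LinearEquiv.prodCongr ψ (LinearEquiv.refl R _)) ≪≫ₗ
        (LinearEquiv.prodAssoc R _ _ _) ≪≫ₗ
        (LinearEquiv.prodCongr (LinearEquiv.refl R _) φ) ≪≫ₗ
        (piFinSuccEquiv fun i => R ⧸ (Fin.cons (a ⊔ d 0) e : Fin (r + 2) → Ideal R) i).symm⟩

/-- Every finite direct sum of cyclic torsion modules can be rewritten with a divisibility chain. -/
theorem exists_chain_equiv [IsDedekindDomain R] {r : ℕ} (a : Fin r → Ideal R)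
    (ha : ∀ i, a i ≠ ⊥) :
    ∃ d : Fin r → Ideal R, (∀ i, d i ≠ ⊥) ∧ (∀ i j, i ≤ j → d i ∣ d j) ∧
      Nonempty ((∀ i, R ⧸ a i) ≃ₗ[R] ∀ i, R ⧸ d i) := by
  induction r with
  | zero => exact ⟨a, ha, fun i => i.elim0, ⟨LinearEquiv.refl R _⟩⟩
  | succ r ih =>
    obtain ⟨d, hd, hchain, ⟨φ⟩⟩ := ih (fun i => a i.succ) fun i => ha _
    obtain ⟨e, he, hchain', -, ⟨ψ⟩⟩ := exists_chain_insert (a 0) d (ha 0) hd hchain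
    exact ⟨e, he, hchain', ⟨piFinSuccEquiv (fun i => R ⧸ a i) ≪≫ₗ
      LinearEquiv.prodCongr (LinearEquiv.refl R _) φ ≪≫ₗ ψ⟩⟩

end Chain

/-! ### Ranks of torsion-free modules and their reductions -/

section Rank
open Module TensorProduct

variable {R : Type*} [CommRing R]

/-- The rank of a finite flat module does not change under specialization, so it can be read off at
the generic point. -/
theorem rankAtStalk_eq_finrank [IsDomain R] (P : Type*) [AddCommGroup P] [Module R P]
    [Module.Finite R P] [Module.Flat R P] (p : PrimeSpectrum R) :
    rankAtStalk P p = finrank R P := by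
  have h := rankAtStalk_eq_of_le_of_finite_of_flat (R := R) P
    (p := ⟨⊥, Ideal.isPrime_bot⟩) (q := p) (show (⊥ : Ideal R) ≤ _ from bot_le)
  rw [← h, rankAtStalk]
  have hle : (⊥ : Ideal R).primeCompl ≤ nonZeroDivisors R :=
    Ideal.primeCompl_le_nonZeroDivisors _
  rw [← IsLocalizedModule.finrank_eq (⊥ : Ideal R).primeCompl
    (LocalizedModule.mkLinearMap (⊥ : Ideal R).primeCompl P) hle]
  exact IsLocalization.finrank_eq _ (⊥ : Ideal R).primeCompl hle

/-- A finite torsion-free module over a Dedekind domain becomes free of the same rank modulo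
an ideal with finite quotient. -/
theorem nonempty_basis_quotient_tensor [IsDedekindDomain R] (P : Type*) [AddCommGroup P]
    [Module R P] [Module.Finite R P] [Module.IsTorsionFree R P] (a : Ideal R) [Finite (R ⧸ a)] :
    Nonempty (Basis (Fin (finrank R P)) (R ⧸ a) ((R ⧸ a) ⊗[R] P)) := by
  -- The finite ring `R ⧸ a` is semilocal, so freeness of a flat module follows from equal
  -- dimensions at all its residue fields.
  refine nonempty_basis_of_flat_of_finrank_eq _ _ _ fun m => ?_
  have := m.isMaximal
  let : Field ((R ⧸ a) ⧸ m.1) := Ideal.Quotient.field m.1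
  have h := rankAtStalk_eq_finrank_of_free (R := (R ⧸ a) ⧸ m.1)
    (M := ((R ⧸ a) ⧸ m.1) ⊗[R ⧸ a] ((R ⧸ a) ⊗[R] P))
  have h' := congrFun h ⟨⊥, Ideal.isPrime_bot⟩
  rw [rankAtStalk_baseChange, rankAtStalk_baseChange, rankAtStalk_eq_finrank] at h'
  simpa using h'.symm

theorem projective_of_isTorsionFree [IsDedekindDomain R] (P : Type*) [AddCommGroup P]
    [Module R P] [Module.Finite R P] [Module.IsTorsionFree R P] : Module.Projective R P :=
  have := Module.finitePresentation_of_finite R P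
  Module.Flat.projective_of_finitePresentation

end Rank

/-! ### Ideals and residue rings of a localization -/

section Localization

variable {O : Type*} [CommRing O]

theorem le_nonZeroDivisors_of_zero_notMem [IsDomain O] {S : Submonoid O} (hS : (0 : O) ∉ S) :
    S ≤ nonZeroDivisors O :=
  fun _ hs => mem_nonZeroDivisors_of_ne_zero fun h => hS (h ▸ hs)

theorem isDomain_of_isLocalization [IsDomain O] {S : Submonoid O} (hS : (0 : O) ∉ S)
    (OS : Type*) [CommRing OS] [Algebra O OS] [IsLocalization S OS] : IsDomain OS :=
  IsLocalization.isDomain_of_le_nonZeroDivisors OS (le_nonZeroDivisors_of_zero_notMem hS)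

theorem isDedekindDomain_of_isLocalization [IsDedekindDomain O] {S : Submonoid O}
    (hS : (0 : O) ∉ S) (OS : Type*) [CommRing OS] [Algebra O OS] [IsLocalization S OS] :
    IsDedekindDomain OS :=
  have := isDomain_of_isLocalization hS OS
  IsLocalization.isDedekindDomain O (le_nonZeroDivisors_of_zero_notMem hS) OS

variable {S : Submonoid O} {OS : Type*} [CommRing OS] [Algebra O OS] [IsLocalization S OS]
  {A : Ideal OS}

theorem comap_ne_bot (S : Submonoid O) [IsLocalization S OS] (hA : A ≠ ⊥) :
    A.comap (algebraMap O OS) ≠ ⊥ := fun h => hA <| by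
  rw [← IsLocalization.map_under S OS A, Ideal.under, h, Ideal.map_bot]

variable [Ring.HasFiniteQuotients O]

/-- Elements of `S` are invertible modulo the contraction of a nonzero ideal of the localization. -/
theorem exists_mul_sub_one_mem_comap (hA : A ≠ ⊥) {s : O} (hs : s ∈ S) :
    ∃ t, t * s - 1 ∈ A.comap (algebraMap O OS) := by
  have : Finite (O ⧸ A.comap (algebraMap O OS)) :=
    Ring.HasFiniteQuotients.finiteQuotient (comap_ne_bot S hA)
  -- `s` becomes a unit in `OS`, so multiplication by it is injective on a ring that embeds in `OS ⧸
  -- A`; finiteness makes it surjective.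
  have hinj : Function.Injective
      fun x : O ⧸ A.comap (algebraMap O OS) => Ideal.Quotient.mk _ s * x := by
    rw [← AddMonoidHom.coe_mulLeft, injective_iff_map_eq_zero]
    intro x hx
    obtain ⟨x, rfl⟩ := Ideal.Quotient.mk_surjective x
    rw [AddMonoidHom.coe_mulLeft, ← map_mul, Ideal.Quotient.eq_zero_iff_mem, Ideal.mem_comap,
      map_mul] at hx
    rw [Ideal.Quotient.eq_zero_iff_mem, Ideal.mem_comap]
    exact (Ideal.unit_mul_mem_iff_mem A (IsLocalization.map_units OS ⟨s, hs⟩)).1 hx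
  obtain ⟨t, ht⟩ := Finite.surjective_of_injective hinj 1
  obtain ⟨t, rfl⟩ := Ideal.Quotient.mk_surjective t
  refine ⟨t, Ideal.Quotient.eq.1 ?_⟩
  rw [mul_comm, map_mul, map_one]
  exact ht

/-- A fraction `x / s` is congruent to `t x`, where `t` inverts `s` modulo the contraction of `A`.
-/
theorem quotientMap_algebraMap_bijective (S : Submonoid O) [IsLocalization S OS] (hA : A ≠ ⊥) :
    Function.Bijective (Ideal.quotientMap A (algebraMap O OS) le_rfl) := by
  refine ⟨Ideal.quotientMap_injective, fun y => ?_⟩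
  obtain ⟨y, rfl⟩ := Ideal.Quotient.mk_surjective y
  obtain ⟨⟨x, s⟩, hx⟩ := IsLocalization.surj S y
  obtain ⟨t, ht⟩ := exists_mul_sub_one_mem_comap (S := S) hA s.2
  refine ⟨Ideal.Quotient.mk _ (t * x), ?_⟩
  rw [Ideal.quotientMap_mk, Ideal.Quotient.eq, map_mul, ← hx]
  rw [Ideal.mem_comap, map_sub, map_mul, map_one] at ht
  convert A.mul_mem_left y ht using 1
  ring

/-- Elements of `S` are invertible modulo `b`, so `s x ∈ b` implies `x ∈ b`. -/
theorem comap_map_eq_of_comap_le (S : Submonoid O) [IsLocalization S OS] (hA : A ≠ ⊥)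
    {b : Ideal O} (hb : A.comap (algebraMap O OS) ≤ b) :
    (b.map (algebraMap O OS)).comap (algebraMap O OS) = b := by
  refine le_antisymm (fun x hx => ?_) Ideal.le_comap_map
  obtain ⟨s, hs, hsx⟩ := (IsLocalization.algebraMap_mem_map_algebraMap_iff S OS b x).1 hx
  obtain ⟨t, ht⟩ := exists_mul_sub_one_mem_comap (S := S) hA hs
  have : x = t * (s * x) - (t * s - 1) * x := by ring
  rw [this]
  exact sub_mem (b.mul_mem_left _ hsx) (b.mul_mem_right _ (hb ht))

theorem hasFiniteQuotients_of_isLocalization (S : Submonoid O) (OS : Type*) [CommRing OS]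
    [Algebra O OS] [IsLocalization S OS] : Ring.HasFiniteQuotients OS where
  finiteQuotient {A} hA :=
    have : Finite (O ⧸ A.comap (algebraMap O OS)) :=
      Ring.HasFiniteQuotients.finiteQuotient (comap_ne_bot S hA)
    Finite.of_surjective _ (quotientMap_algebraMap_bijective S hA).2

theorem idealNorm_comap (S : Submonoid O) [IsLocalization S OS] (hA : A ≠ ⊥) :
    idealNorm (A.comap (algebraMap O OS)) = idealNorm A :=
  Nat.card_congr (Equiv.ofBijective _ (quotientMap_algebraMap_bijective S hA))

/-- The ideal on the left is the extension of the one on the right, which contains the contraction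
of `A` and is therefore recovered by contracting. -/
theorem idealNorm_sup_map (S : Submonoid O) [IsLocalization S OS] (hA : A ≠ ⊥) (d : Ideal O) :
    idealNorm (A ⊔ d.map (algebraMap O OS)) =
      idealNorm (A.comap (algebraMap O OS) ⊔ d) := by
  have h : A ⊔ d.map (algebraMap O OS) =
      (A.comap (algebraMap O OS) ⊔ d).map (algebraMap O OS) := by
    rw [Ideal.map_sup, ← Ideal.under_def, IsLocalization.map_under S OS A]
  rw [← idealNorm_comap S (fun h => hA (le_bot_iff.1 (le_sup_left.trans_eq h))), h,
    comap_map_eq_of_comap_le S hA le_sup_left]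

end Localization

/-! ### Torsion modules as sums of cyclic modules -/

section Cyclic

variable {R : Type*} [CommRing R]

/-- The elements of `R` that are invertible modulo `I`. -/
def unitsMod (I : Ideal R) : Submonoid R :=
  (IsUnit.submonoid (R ⧸ I)).comap (Ideal.Quotient.mk I)

theorem zero_notMem_unitsMod {I : Ideal R} (hI : I ≠ ⊤) : (0 : R) ∉ unitsMod I := fun h => by
  have := Ideal.Quotient.nontrivial_iff.2 hI
  have h : IsUnit (Ideal.Quotient.mk I 0) := h
  exact not_isUnit_zero (map_zero (Ideal.Quotient.mk I) ▸ h)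

variable [IsDedekindDomain R]

/-- A nonzero prime not containing `I` is comaximal with it, hence contains an element congruent to
`1` modulo `I`. -/
theorem le_or_eq_bot_of_disjoint_unitsMod {I p : Ideal R} [p.IsPrime]
    (h : Disjoint (unitsMod I : Set R) p) : I ≤ p ∨ p = ⊥ := by
  refine or_iff_not_imp_right.2 fun hp => ?_
  have hmax : p.IsMaximal := Ideal.IsPrime.isMaximal ‹_› hp
  by_contra hI
  have htop : (1 : R) ∈ p ⊔ I := (Ideal.eq_top_iff_one _).1 (hmax.out.2 _ (left_lt_sup.2 hI))
  obtain ⟨x, hx, y, hy, hxy⟩ := Submodule.mem_sup.1 htop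
  refine Set.disjoint_left.1 h (show IsUnit (Ideal.Quotient.mk I x) from ?_) hx
  have h1 : Ideal.Quotient.mk I x = 1 := by
    rw [← map_one (Ideal.Quotient.mk I), ← hxy, map_add, Ideal.Quotient.eq_zero_iff_mem.2 hy,
      add_zero]
  rw [h1]
  exact isUnit_one

variable [Ring.HasFiniteQuotients R]

/-- Apart from `⊥`, maximal ideals contract to primes above `I`, which come from the finite ring `R
⧸ I`. A Dedekind domain with finitely many maximal ideals is principal. -/
theorem isPrincipalIdealRing_localization_unitsMod {I : Ideal R} (hI : I ≠ ⊥) (hI' : I ≠ ⊤) :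
    IsPrincipalIdealRing (Localization (unitsMod I)) := by
  have := isDedekindDomain_of_isLocalization (zero_notMem_unitsMod hI')
    (Localization (unitsMod I))
  refine IsPrincipalIdealRing.of_finite_maximals ?_
  have := Ring.HasFiniteQuotients.finiteQuotient hI
  refine Set.Finite.of_finite_image (f := Ideal.comap (algebraMap R (Localization (unitsMod I))))
    (((Set.finite_range (Ideal.comap (Ideal.Quotient.mk I))).union (Set.finite_singleton ⊥)).subset
      ?_) fun P _ Q _ h => ?_
  · rintro _ ⟨P, hP, rfl⟩
    have hP' : P.IsMaximal := hP
    have hd := ((IsLocalization.isPrime_iff_isPrime_disjoint (unitsMod I) _ P).1 hP'.isPrime)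
    have := hd.1
    refine (le_or_eq_bot_of_disjoint_unitsMod hd.2).imp (fun h => ?_) id
    exact ⟨_, Ideal.comap_map_mk h⟩
  · rw [← IsLocalization.map_under (unitsMod I) _ P, ← IsLocalization.map_under (unitsMod I) _ Q]
    exact congrArg _ h

/-- The residue ring of a nonzero ideal of a localization, as a quotient of the base ring. -/
noncomputable def quotientComapEquiv (S : Submonoid R) {R' : Type*} [CommRing R'] [Algebra R R']
    [IsLocalization S R'] {A : Ideal R'} (hA : A ≠ ⊥) :
    (R ⧸ A.comap (algebraMap R R')) ≃ₗ[R] R' ⧸ A :=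
  LinearEquiv.ofBijective
    { toFun := Ideal.quotientMap A (algebraMap R R') le_rfl
      map_add' := map_add _
      map_smul' := fun r x => by
        obtain ⟨x, rfl⟩ := Ideal.Quotient.mk_surjective x
        change Ideal.Quotient.mk A (algebraMap R R' (r * x)) = r • Ideal.Quotient.mk A _
        rw [map_mul, ← Algebra.smul_def]
        rfl }
    (quotientMap_algebraMap_bijective S hA)

/-- A nonzero `b` kills `T`, so `T` is a module over the principal ideal domain obtained by
inverting everything invertible modulo `b`. Smith normal form applies there, and its cyclic factors
are residue rings of `R` too. The number of factors equals the number of generators. -/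
theorem exists_equiv_pi_quotient {T : Type*} [AddCommGroup T] [Module R T]
    (hT : Module.IsTorsion R T) {r : ℕ} (v : Fin r → T)
    (hv : Submodule.span R (Set.range v) = ⊤) :
    ∃ a : Fin r → Ideal R, (∀ i, a i ≠ ⊥) ∧ Nonempty (T ≃ₗ[R] ∀ i, R ⧸ a i) := by
  have : Module.Finite R T := ⟨⟨(Set.finite_range v).toFinset, by simpa using hv⟩⟩
  obtain ⟨b, hb, hb0⟩ := Submodule.annihilator_top_inter_nonZeroDivisors hT
  have hb0 : b ≠ 0 := nonZeroDivisors.ne_zero hb0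
  have hbT : ∀ t : T, b • t = 0 := fun t => Submodule.mem_annihilator.1 hb t trivial
  -- If `b` is a unit, `T` vanishes, and the localization used below would be the zero ring.
  by_cases hu : IsUnit b
  · have : Subsingleton T := subsingleton_of_forall_eq 0 fun t => hu.smul_eq_zero.1 (hbT t)
    refine ⟨fun _ => ⊤, fun _ => top_ne_bot, ⟨?_⟩⟩
    have : Subsingleton (R ⧸ (⊤ : Ideal R)) := Ideal.Quotient.subsingleton_iff.2 rfl
    exact LinearEquiv.ofSubsingleton _ _
  have hI : Ideal.span {b} ≠ ⊥ := by simpa using hb0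
  have hI' : Ideal.span {b} ≠ ⊤ := by simpa [Ideal.span_singleton_eq_top] using hu
  set I := Ideal.span {b} with hIdef
  have hS := zero_notMem_unitsMod hI'
  let R' := Localization (unitsMod I)
  have : IsDedekindDomain R' := isDedekindDomain_of_isLocalization hS R'
  have : IsPrincipalIdealRing R' := isPrincipalIdealRing_localization_unitsMod hI hI'
  have hTI : Module.IsTorsionBySet R T I := by
    exact (Module.isTorsionBySet_span_singleton_iff b).2 fun t => hbT t
  let _ : Module (R ⧸ I) T := hTI.module
  let ψ : R' →+* R ⧸ I := IsLocalization.lift (M := unitsMod I) (g := Ideal.Quotient.mk I)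
    fun y => y.2
  let _ : Module R' T := Module.compHom T ψ
  have htower : IsScalarTower R R' T := IsScalarTower.of_algebraMap_smul fun x t => by
    change ψ (algebraMap R R' x) • t = x • t
    rw [show ψ (algebraMap R R' x) = Ideal.Quotient.mk I x from IsLocalization.lift_eq _ x]
    rfl
  have hb' : algebraMap R R' b ≠ 0 := fun h => hb0 <|
    IsLocalization.injective R' (le_nonZeroDivisors_of_zero_notMem hS) (h.trans (map_zero _).symm)
  have hbT' : ∀ t : T, algebraMap R R' b • t = 0 := fun t => by
    rw [algebraMap_smul, hbT]
  let f := Fintype.linearCombination R' v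
  have hf : Function.Surjective f := by
    rw [← LinearMap.range_eq_top, Fintype.range_linearCombination]
    refine eq_top_iff.2 fun t _ => ?_
    exact Submodule.span_le_restrictScalars R R' _ (hv ▸ Submodule.mem_top)
  have hrank : Module.finrank R' (LinearMap.ker f) = Module.finrank R' (Fin r → R') := by
    have : Module.Finite R' T := Module.Finite.of_surjective f hf
    have h0 : Module.finrank R' T = 0 := Module.finrank_eq_zero_iff_isTorsion.2
      fun {t} => ⟨⟨_, mem_nonZeroDivisors_of_ne_zero hb'⟩, hbT' t⟩
    rw [← (LinearMap.ker f).finrank_quotient_add_finrank,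
      (f.quotKerEquivOfSurjective hf).finrank_eq, h0, zero_add]
  let E := (f.quotKerEquivOfSurjective hf).symm ≪≫ₗ
    (LinearMap.ker f).quotientEquivPiSpan (Pi.basisFun R' (Fin r)) hrank
  set c := Submodule.smithNormalFormCoeffs (Pi.basisFun R' (Fin r)) hrank
  -- As `b` kills the `i`-th cyclic factor, its image lies in `(c i)`.
  have hc : ∀ i, Ideal.span {c i} ≠ ⊥ := fun i hi => hb' <| by
    have h := hbT' (E.symm (Pi.single i 1))
    rw [← map_smul, LinearEquiv.map_eq_zero_iff] at h
    have h := congrFun h i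
    rw [Pi.smul_apply, Pi.single_eq_same, Pi.zero_apply] at h
    have : algebraMap R R' b ∈ Ideal.span {c i} := by
      rw [← Ideal.Quotient.eq_zero_iff_mem, ← h, Algebra.smul_def, mul_one]
      rfl
    rwa [hi] at this
  refine ⟨fun i => (Ideal.span {c i}).comap (algebraMap R R'),
    fun i => comap_ne_bot (unitsMod I) (hc i), ⟨E.restrictScalars R ≪≫ₗ
      LinearEquiv.piCongrRight fun i => (quotientComapEquiv (unitsMod I) (hc i)).symm⟩⟩

end Cyclic

/-! ### Invariant ideals and counting solutions modulo an ideal -/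

section Coker
open Module TensorProduct

variable {R : Type*} [CommRing R] [IsDedekindDomain R] [Ring.HasFiniteQuotients R]

/-- The torsion of a quotient `F / N` of a torsion-free module is a sum of `rank N` cyclic modules
that form a divisibility chain. -/
theorem exists_isInvariantIdeals {F : Type*} [AddCommGroup F] [Module R F] [Module.Finite R F]
    [Module.IsTorsionFree R F] (N : Submodule R F) {r : ℕ} (hr : finrank R N = r) :
    ∃ d : Fin r → Ideal R, IsInvariantIdeals (F ⧸ N) d := by
  let T := Submodule.torsion R (F ⧸ N)
  have hT : Module.IsTorsion R T := Submodule.torsion_isTorsion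
  -- `L` is the saturation of `N`: it has the same rank, and `L / N` is the torsion of `F / N`.
  let L := T.comap N.mkQ
  let g : L →ₗ[R] T := N.mkQ.restrict fun _ h => h
  have hg : Function.Surjective g := fun ⟨t, ht⟩ => by
    obtain ⟨x, rfl⟩ := N.mkQ_surjective t
    exact ⟨⟨x, ht⟩, rfl⟩
  have hker : LinearMap.ker g = N.comap L.subtype := by
    ext x
    rw [LinearMap.mem_ker, ← Submodule.coe_eq_zero]
    exact Submodule.Quotient.mk_eq_zero N
  have hNL : N ≤ L := fun x hx => by
    have : N.mkQ x = 0 := (Submodule.Quotient.mk_eq_zero N).2 hx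
    change N.mkQ x ∈ T
    rw [this]
    exact zero_mem T
  have hL : finrank R L = r := by
    rw [← (LinearMap.ker g).finrank_quotient_add_finrank,
      (g.quotKerEquivOfSurjective hg).finrank_eq, finrank_eq_zero_iff_isTorsion.2 hT, zero_add,
      hker, (Submodule.comapSubtypeEquivOfLe hNL).finrank_eq, hr]
  obtain ⟨b, hb, hb0⟩ := Submodule.annihilator_top_inter_nonZeroDivisors hT
  have hI : Ideal.span {b} ≠ ⊥ := by simpa using nonZeroDivisors.ne_zero hb0
  have := Ring.HasFiniteQuotients.finiteQuotient hI
  -- `L` need not be free, but `L / b L` is free of rank `r` over `R / b` and maps onto `T`; so `r`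
  -- generators suffice.
  obtain ⟨B⟩ := nonempty_basis_quotient_tensor L (Ideal.span {b})
  rw [hL] at B
  have hI0 : Ideal.span {b} • (⊤ : Submodule R L) ≤ LinearMap.ker g := by
    rw [Submodule.ideal_span_singleton_smul]
    rintro _ ⟨x, -, rfl⟩
    exact (map_smul g b x).trans (Submodule.mem_annihilator.1 hb _ trivial)
  let h : (R ⧸ Ideal.span {b}) ⊗[R] L →ₗ[R] T :=
    Submodule.liftQ _ g hI0 ∘ₗ (quotTensorEquivQuotSMul L (Ideal.span {b})).toLinearMap
  have hh : ∀ x : L, h (1 ⊗ₜ x) = g x := fun x => by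
    simp only [h, LinearMap.comp_apply, LinearEquiv.coe_coe]
    rw [← map_one (Ideal.Quotient.mk _), quotTensorEquivQuotSMul_mk_tmul, one_smul]
    rfl
  have hsurj : Function.Surjective h := fun t => by
    obtain ⟨x, rfl⟩ := hg t
    exact ⟨_, hh x⟩
  have hspan : Submodule.span R (Set.range (h ∘ B)) = ⊤ := by
    rw [Set.range_comp, Submodule.span_image, ← Submodule.restrictScalars_span R
      (R ⧸ Ideal.span {b}) Ideal.Quotient.mk_surjective, B.span_eq,
      Submodule.restrictScalars_top, Submodule.map_top, LinearMap.range_eq_top.2 hsurj]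
  obtain ⟨a, ha, ⟨e⟩⟩ := exists_equiv_pi_quotient hT (h ∘ B) hspan
  obtain ⟨d, hd, hchain, ⟨e'⟩⟩ := exists_chain_equiv a ha
  exact ⟨d, hd, hchain, ⟨e ≪≫ₗ e'⟩⟩

omit [IsDedekindDomain R] in
theorem idealNorm_ne_zero {a : Ideal R} (ha : a ≠ ⊥) : idealNorm a ≠ 0 :=
  have := Ring.HasFiniteQuotients.finiteQuotient ha
  Nat.card_ne_zero.2 ⟨⟨0⟩, this⟩

omit [IsDedekindDomain R] [Ring.HasFiniteQuotients R] in
theorem card_quotient_tensor_quotient (a d : Ideal R) :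
    Nat.card ((R ⧸ a) ⊗[R] (R ⧸ d)) = idealNorm (a ⊔ d) := by
  have h : a • (⊤ : Submodule R (R ⧸ d)) = Submodule.map d.mkQ a := by
    rw [← LinearMap.range_eq_top.2 d.mkQ_surjective, LinearMap.range_eq_map,
      ← Submodule.map_smul'', smul_eq_mul, Ideal.mul_top]
  rw [Nat.card_congr (quotTensorEquivQuotSMul (R ⧸ d) a).toEquiv, h, sup_comm]
  exact Nat.card_congr (Submodule.quotientQuotientEquivQuotientSup d a).toEquiv

/-- The torsion-free quotient is projective, so `M` splits as torsion plus a part that becomes free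
modulo `a`; each torsion factor `R/d` contributes `R/(a + d)`. -/
theorem card_quotient_tensor {M : Type*} [AddCommGroup M] [Module R M] [Module.Finite R M]
    {r : ℕ} {d : Fin r → Ideal R} (hd : IsInvariantIdeals M d) {a : Ideal R} (ha : a ≠ ⊥) :
    Nat.card ((R ⧸ a) ⊗[R] M) = idealNorm a ^ finrank R M * ∏ i, idealNorm (a ⊔ d i) := by
  obtain ⟨-, -, ⟨e⟩⟩ := hd
  have := Ring.HasFiniteQuotients.finiteQuotient ha
  let T := Submodule.torsion R M
  have hT : Module.IsTorsion R T := Submodule.torsion_isTorsion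
  have := projective_of_isTorsionFree (R := R) (M ⧸ T)
  obtain ⟨B⟩ := nonempty_basis_quotient_tensor (R := R) (M ⧸ T) a
  have hrank : finrank R (M ⧸ T) = finrank R M := by
    rw [← T.finrank_quotient_add_finrank, finrank_eq_zero_iff_isTorsion.2 hT, add_zero]
  have hP : Nat.card ((R ⧸ a) ⊗[R] (M ⧸ T)) = idealNorm a ^ finrank R M := by
    rw [Nat.card_congr B.equivFun.toEquiv, Nat.card_fun, Nat.card_fin, hrank]
    rfl
  have hTc : Nat.card ((R ⧸ a) ⊗[R] T) = ∏ i, idealNorm (a ⊔ d i) := by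
    rw [Nat.card_congr ((LinearEquiv.lTensor (R ⧸ a) e) ≪≫ₗ
      TensorProduct.piRight R R (R ⧸ a) fun i => R ⧸ d i).toEquiv, Nat.card_pi]
    exact Finset.prod_congr rfl fun i _ => card_quotient_tensor_quotient a (d i)
  obtain ⟨l, hl⟩ := LinearMap.exists_rightInverse_of_surjective T.mkQ
    (LinearMap.range_eq_top.2 T.mkQ_surjective)
  have hex : Function.Exact T.subtype T.mkQ := LinearMap.exact_subtype_mkQ T
  let E := (hex.splitSurjectiveEquiv T.injective_subtype ⟨l, hl⟩).1
  rw [Nat.card_congr ((LinearEquiv.lTensor (R ⧸ a) E) ≪≫ₗ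
    TensorProduct.prodRight R R (R ⧸ a) T (M ⧸ T)).toEquiv, Nat.card_prod, hTc, hP, mul_comm]

variable {n ℓ : ℕ} (c : Fin n → Fin ℓ → R) (J : Finset (Fin n))

theorem isInvariantIdeals_invariantIdeal : IsInvariantIdeals (Coker c J) (invariantIdeal c J) := by
  have h : ∃ d : Fin (rk c J) → Ideal R, IsInvariantIdeals (Coker c J) d :=
    exists_isInvariantIdeals _ rfl
  rw [invariantIdeal, dif_pos h]
  exact h.choose_spec

omit [IsDedekindDomain R] [Ring.HasFiniteQuotients R] in
theorem rk_le [IsDomain R] : rk c J ≤ ℓ :=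
  (LinearMap.finrank_range_le (phi c J)).trans_eq (by simp)

/-- The number of solutions modulo `a` of the homogeneous system with coefficients `c j`,
`j ∈ J`. -/
theorem card_ker_lTensor_phi {a : Ideal R} (ha : a ≠ ⊥) :
    Nat.card (LinearMap.ker ((phi c J).lTensor (R ⧸ a))) =
      idealNorm a ^ (ℓ - rk c J) * ∏ i, idealNorm (a ⊔ invariantIdeal c J i) := by
  have := Ring.HasFiniteQuotients.finiteQuotient ha
  let f := (phi c J).lTensor (R ⧸ a)
  let g := (LinearMap.range (phi c J)).mkQ.lTensor (R ⧸ a)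
  have hex : Function.Exact f g := lTensor_exact (R ⧸ a)
    (LinearMap.exact_map_mkQ_range _) (Submodule.mkQ_surjective _)
  have hg : Function.Surjective g := LinearMap.lTensor_surjective _ (Submodule.mkQ_surjective _)
  have hpi : ∀ (ι : Type) [Fintype ι], Nat.card ((R ⧸ a) ⊗[R] (ι → R)) =
      idealNorm a ^ Fintype.card ι := fun ι _ => by
    classical
    rw [Nat.card_congr (TensorProduct.piScalarRight R R (R ⧸ a) ι).toEquiv, Nat.card_fun,
      Nat.card_eq_fintype_card (α := ι)]
    rfl
  have h1 : Nat.card (LinearMap.ker f) * Nat.card (LinearMap.range f) = idealNorm a ^ ℓ := by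
    rw [← Nat.card_congr f.quotKerEquivRange.toEquiv,
      ← Submodule.card_eq_card_quotient_mul_card, hpi, Fintype.card_fin]
  -- By right exactness of the tensor product, the cokernel of `f` is the reduction of `Coker c J`.
  -- This gives the size of the range, and `h1` then gives the kernel.
  have h2 : Nat.card (LinearMap.range f) * Nat.card ((R ⧸ a) ⊗[R] Coker c J) =
      idealNorm a ^ J.card := by
    rw [← Nat.card_congr (g.quotKerEquivOfSurjective hg).toEquiv, hex.linearMap_ker_eq,
      ← Submodule.card_eq_card_quotient_mul_card, hpi, Fintype.card_coe]
  rw [card_quotient_tensor (isInvariantIdeals_invariantIdeal c J) ha] at h2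
  have h3 : finrank R (Coker c J) + rk c J = J.card := by
    rw [rk, Submodule.finrank_quotient_add_finrank]
    simp
  have hq : idealNorm a ≠ 0 := idealNorm_ne_zero ha
  have h4 : Nat.card (LinearMap.range f) * ∏ i, idealNorm (a ⊔ invariantIdeal c J i) =
      idealNorm a ^ rk c J := by
    refine mul_left_cancel₀ (pow_ne_zero (finrank R (Coker c J)) hq) ?_
    rw [← pow_add, h3, ← h2]
    ring
  have h5 : Nat.card (LinearMap.range f) ≠ 0 := fun h => by
    rw [h, zero_mul] at h4
    exact pow_ne_zero _ hq h4.symm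
  refine mul_right_cancel₀ h5 (h1.trans ?_)
  rw [mul_assoc, mul_comm (∏ i, _), h4, ← pow_add, Nat.sub_add_cancel (rk_le c J)]

end Coker

/-! ### A divisibility chain is determined by its norm products -/

section Uniqueness

variable {R : Type*} [CommRing R]

theorem idealNorm_lt [Ring.HasFiniteQuotients R] {a b : Ideal R} (ha : a ≠ ⊥) (hab : a < b) :
    idealNorm b < idealNorm a := by
  have := Ring.HasFiniteQuotients.finiteQuotient ha
  have hsurj : Function.Surjective (Ideal.Quotient.factor hab.le) :=
    Ideal.Quotient.factor_surjective hab.le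
  refine (Nat.card_le_card_of_surjective _ hsurj).lt_of_ne fun h => ?_
  have hinj := (hsurj.bijective_of_nat_card_le h.ge).1
  refine hab.not_ge fun x hx => ?_
  rw [← Ideal.Quotient.eq_zero_iff_mem] at hx ⊢
  exact hinj (((Ideal.Quotient.factor_mk hab.le x).trans hx).trans (map_zero _).symm)

variable [IsDedekindDomain R]

open Classical in
-- Passing from `p ^ e` to `p ^ (e + 1)` changes the norm of the sum with `d` only if `p ^ (e + 1) ∣
-- d`. Over a chain, these jumps count the terms divisible by `p ^ (e + 1)`.
theorem idealNorm_prime_pow_succ_sup (p : Ideal R) (hp : Prime p) (e : ℕ) (d : Ideal R) :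
    idealNorm (p ^ (e + 1) ⊔ d) * idealNorm (p ^ e) = idealNorm (p ^ e ⊔ d) *
      if p ^ (e + 1) ∣ d then idealNorm (p ^ (e + 1)) else idealNorm (p ^ e) := by
  split_ifs with h
  · rw [sup_eq_left.2 (Ideal.dvd_iff_le.1 h),
      sup_eq_left.2 (Ideal.dvd_iff_le.1 ((pow_dvd_pow p e.le_succ).trans h)), mul_comm]
  · obtain ⟨k, hk, hpk⟩ := (dvd_prime_pow hp (e + 1)).1
      (Ideal.dvd_iff_le.2 (le_sup_left : p ^ (e + 1) ≤ p ^ (e + 1) ⊔ d))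
    rw [associated_iff_eq] at hpk
    have hke : k ≤ e := by
      by_contra hke
      obtain rfl : k = e + 1 := by omega
      exact h (Ideal.dvd_iff_le.2 (sup_eq_left.1 hpk))
    have : p ^ e ≤ p ^ (e + 1) ⊔ d := hpk ▸ Ideal.pow_le_pow_right hke
    rw [le_antisymm (sup_le (Ideal.pow_le_pow_right e.le_succ |>.trans le_sup_left) le_sup_right)
      (sup_le this le_sup_right : p ^ e ⊔ d ≤ p ^ (e + 1) ⊔ d)]

variable [Ring.HasFiniteQuotients R]

/-- A chain `d_1 ∣ ⋯ ∣ d_r` of nonzero ideals is determined by the numbers `∏ N(a + d_i)`. -/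
theorem eq_of_forall_prod_idealNorm_sup {r : ℕ} {d d' : Fin r → Ideal R} (hd : ∀ i, d i ≠ ⊥)
    (hd' : ∀ i, d' i ≠ ⊥) (hc : ∀ i j, i ≤ j → d i ∣ d j) (hc' : ∀ i j, i ≤ j → d' i ∣ d' j)
    (h : ∀ a : Ideal R, a ≠ ⊥ → ∏ i, idealNorm (a ⊔ d i) = ∏ i, idealNorm (a ⊔ d' i)) :
    d = d' := by
  classical
  have key : ∀ (d d' : Fin r → Ideal R), (∀ i j, i ≤ j → d i ∣ d j) →
      (∀ i j, i ≤ j → d' i ∣ d' j) →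
      (∀ a : Ideal R, a ≠ ⊥ → ∏ i, idealNorm (a ⊔ d i) = ∏ i, idealNorm (a ⊔ d' i)) →
      ∀ (p : Ideal R), Prime p → ∀ (e : ℕ) (i), p ^ (e + 1) ∣ d i → p ^ (e + 1) ∣ d' i := by
    intro d d' hc hc' h p hp e i hi
    by_contra hi'
    have hpe : ∀ k, p ^ k ≠ ⊥ := fun k => pow_ne_zero k hp.ne_zero
    have hlt : idealNorm (p ^ e) < idealNorm (p ^ (e + 1)) :=
      idealNorm_lt (hpe _) (Ideal.pow_right_strictAnti p hp.ne_zero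
        (fun h => hp.not_isUnit (Ideal.isUnit_iff.2 h)) e.lt_succ_self)
    have hpos : 0 < idealNorm (p ^ e) := (idealNorm_ne_zero (hpe e)).bot_lt
    have hprod : ∀ d : Fin r → Ideal R,
        (∏ i, idealNorm (p ^ (e + 1) ⊔ d i)) * ∏ _i : Fin r, idealNorm (p ^ e) =
        (∏ i, idealNorm (p ^ e ⊔ d i)) *
          ∏ i, if p ^ (e + 1) ∣ d i then idealNorm (p ^ (e + 1)) else idealNorm (p ^ e) :=
      fun d => by
        simp_rw [← Finset.prod_mul_distrib, idealNorm_prime_pow_succ_sup p hp]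
    have h0 : ∏ i, idealNorm (p ^ e ⊔ d' i) ≠ 0 := Finset.prod_ne_zero_iff.2 fun i _ =>
      idealNorm_ne_zero fun h => hpe e (le_bot_iff.1 (le_sup_left.trans_eq h))
    have heq := hprod d
    rw [h _ (hpe _), h _ (hpe _), hprod d'] at heq
    -- The terms divisible by `p ^ (e + 1)` form a final segment of each chain. The segment of `d`
    -- contains `i` and that of `d'` starts after `i`, so the product of jumps for `d` is strictly
    -- larger.
    refine (Finset.prod_lt_prod (fun j _ => ?_) (fun j _ => ?_)
      ⟨i, Finset.mem_univ i, ?_⟩).ne (mul_left_cancel₀ h0 heq)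
    · split_ifs
      exacts [hpos.trans hlt, hpos]
    · by_cases hj : p ^ (e + 1) ∣ d' j
      · have hij : i ≤ j := le_of_not_ge fun hji => hi' (hj.trans (hc' j i hji))
        rw [if_pos hj, if_pos (hi.trans (hc i j hij))]
      · rw [if_neg hj]
        split_ifs
        exacts [hlt.le, le_rfl]
    · rw [if_pos hi, if_neg hi']
      exact hlt
  have hdvd : ∀ (d d' : Fin r → Ideal R), (∀ i, d i ≠ ⊥) → (∀ i j, i ≤ j → d i ∣ d j) →
      (∀ i j, i ≤ j → d' i ∣ d' j) →
      (∀ a : Ideal R, a ≠ ⊥ → ∏ i, idealNorm (a ⊔ d i) = ∏ i, idealNorm (a ⊔ d' i)) →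
      ∀ i, d i ∣ d' i := by
    intro d d' hd hc hc' h i
    refine (UniqueFactorizationMonoid.dvd_iff_emultiplicity_le (hd i)).2 fun p hp => ?_
    refine emultiplicity_le_emultiplicity_iff.2 fun k => ?_
    cases k with
    | zero => simp
    | succ e => exact key d d' hc hc' h p hp e i
  funext i
  exact dvd_antisymm (hdvd d d' hd hc hc' h i)
    (hdvd d' d hd' hc' hc (fun a ha => (h a ha).symm) i)

end Uniqueness

/-! ### Inclusion-exclusion and the constituents -/

section Counting
open TensorProduct

variable {R : Type*} [CommRing R]

theorem mem_reducedHyperplane_iff {ℓ : ℕ} (v : Fin ℓ → R) (a : Ideal R) (y : Fin ℓ → R ⧸ a) :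
    y ∈ reducedHyperplane v a ↔ y ⬝ᵥ (Ideal.Quotient.mk a ∘ v) = 0 := by
  have key : ∀ x : Fin ℓ → R,
      Ideal.Quotient.mk a (x ⬝ᵥ v) = (Ideal.Quotient.mk a ∘ x) ⬝ᵥ (Ideal.Quotient.mk a ∘ v) :=
    fun x => RingHom.map_dotProduct _ _ _
  constructor
  · rintro ⟨x, hx, hxv⟩
    rw [← Ideal.Quotient.eq_zero_iff_mem, key] at hxv
    rwa [← funext (f := Ideal.Quotient.mk a ∘ x) hx]
  · intro h
    choose x hx using fun i => Ideal.Quotient.mk_surjective (y i)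
    refine ⟨x, hx, ?_⟩
    rw [← Ideal.Quotient.eq_zero_iff_mem, key]
    rwa [← funext (f := Ideal.Quotient.mk a ∘ x) hx] at h

variable {n ℓ : ℕ} (c : Fin n → Fin ℓ → R)

theorem phi_apply (J : Finset (Fin n)) (x : Fin ℓ → R) (j : J) : phi c J x j = x ⬝ᵥ c j := rfl

theorem piScalarRight_lTensor_phi (J : Finset (Fin n)) (a : Ideal R)
    (z : (R ⧸ a) ⊗[R] (Fin ℓ → R)) (j : J) :
    piScalarRight R R (R ⧸ a) J ((phi c J).lTensor (R ⧸ a) z) j =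
      piScalarRight R R (R ⧸ a) (Fin ℓ) z ⬝ᵥ (Ideal.Quotient.mk a ∘ c j) := by
  induction z with
  | zero => simp
  | add z w hz hw => rw [map_add, map_add, map_add, Pi.add_apply, hz, hw, add_dotProduct]
  | tmul y x =>
    simp only [LinearMap.lTensor_tmul, piScalarRight_apply, piScalarRightHom_tmul, phi_apply,
      dotProduct, Function.comp_apply, Algebra.smul_def, map_mul, map_sum,
      Ideal.Quotient.algebraMap_eq, Finset.sum_mul]
    exact Finset.sum_congr rfl fun i _ => by ring

theorem card_ker_lTensor_phi_eq (J : Finset (Fin n)) (a : Ideal R) :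
    Nat.card (LinearMap.ker ((phi c J).lTensor (R ⧸ a))) =
      Nat.card {y : Fin ℓ → R ⧸ a // ∀ j ∈ J, y ∈ reducedHyperplane (c j) a} := by
  refine Nat.card_congr ((piScalarRight R R (R ⧸ a) (Fin ℓ)).toEquiv.subtypeEquiv fun z => ?_)
  rw [LinearMap.mem_ker, ← (piScalarRight R R (R ⧸ a) J).map_eq_zero_iff, funext_iff]
  simp_rw [piScalarRight_lTensor_phi, mem_reducedHyperplane_iff]
  exact ⟨fun h j hj => h ⟨j, hj⟩, fun h j => h j j.2⟩

theorem charQuasi_eq_sum (a : Ideal R) [Finite (R ⧸ a)] :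
    charQuasi c a = ∑ J : Finset (Fin n), (-1) ^ J.card *
      (Nat.card (LinearMap.ker ((phi c J).lTensor (R ⧸ a))) : ℤ) := by
  classical
  have := Fintype.ofFinite (R ⧸ a)
  let H : Fin n → Finset (Fin ℓ → R ⧸ a) := fun j => {y | y ∈ reducedHyperplane (c j) a}
  have h := Finset.inclusion_exclusion_card_inf_compl Finset.univ H
  have h1 : complement c a = ↑(Finset.univ.inf fun j => (H j)ᶜ) := by
    ext y
    simp [complement, H, Finset.mem_inf]
  rw [charQuasi, h1, Set.ncard_coe_finset, h, Finset.powerset_univ]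
  refine Finset.sum_congr rfl fun J _ => ?_
  have h2 : ((J.inf H : Finset (Fin ℓ → R ⧸ a)) : Set (Fin ℓ → R ⧸ a)) =
      {y | ∀ j ∈ J, y ∈ reducedHyperplane (c j) a} := by
    ext y
    simp [H, Finset.mem_inf]
  rw [card_ker_lTensor_phi_eq, ← Set.ncard_coe_finset (J.inf H), h2]
  rfl

theorem lcmPeriod_eq_inf : lcmPeriod c =
    (Finset.univ.filter Finset.Nonempty).inf (lastInvariantIdeal c) := by
  rw [lcmPeriod, Finset.inf_eq_iInf]
  simp

variable [IsDedekindDomain R] [Ring.HasFiniteQuotients R]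

theorem invariantIdeal_ne_bot (J : Finset (Fin n)) (i) : invariantIdeal c J i ≠ ⊥ :=
  (isInvariantIdeals_invariantIdeal c J).1 i

theorem invariantIdeal_dvd_last (J : Finset (Fin n)) (i) :
    invariantIdeal c J i ∣ lastInvariantIdeal c J := by
  have hr : 0 < rk c J := i.pos
  rw [lastInvariantIdeal, dif_pos hr]
  exact (isInvariantIdeals_invariantIdeal c J).2.1 _ _ (Fin.le_def.2 (Nat.le_sub_one_of_lt i.2))

theorem lastInvariantIdeal_ne_bot (J : Finset (Fin n)) : lastInvariantIdeal c J ≠ ⊥ := by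
  rw [lastInvariantIdeal]
  split_ifs
  exacts [invariantIdeal_ne_bot c J _, top_ne_bot]

theorem lcmPeriod_le (J : Finset (Fin n)) (i) : lcmPeriod c ≤ invariantIdeal c J i := by
  -- The empty set is left out of the period, but it has rank `0` and so no invariant ideals.
  have hJ : J.Nonempty := by
    by_contra hJ
    rw [Finset.not_nonempty_iff_eq_empty] at hJ
    subst hJ
    have : rk c ∅ = 0 := Module.finrank_zero_of_subsingleton
    exact absurd i.2 (by omega)
  exact (iInf₂_le J hJ).trans (Ideal.dvd_iff_le.1 (invariantIdeal_dvd_last c J i))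

theorem lcmPeriod_ne_bot : lcmPeriod c ≠ ⊥ := by
  rw [lcmPeriod_eq_inf]
  intro h
  have := (Ideal.prod_le_inf (s := Finset.univ.filter Finset.Nonempty)
    (f := lastInvariantIdeal c)).trans h.le
  rw [le_bot_iff, ← Ideal.zero_eq_bot, Finset.prod_eq_zero_iff] at this
  obtain ⟨J, -, hJ⟩ := this
  exact lastInvariantIdeal_ne_bot c J hJ

/-- The polynomial `f_𝒜^κ` is the `κ`-constituent of the characteristic quasi-polynomial. -/
theorem isConstituent_constituent (κ : Ideal R) :
    IsConstituent (charQuasi c) (lcmPeriod c) κ (constituent c κ) := by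
  intro a ha hκ
  have := Ring.HasFiniteQuotients.finiteQuotient ha
  rw [charQuasi_eq_sum, constituent, eval_finsetSum]
  refine Finset.sum_congr rfl fun J _ => ?_
  -- The period is contained in every invariant ideal and is absorbed by it.
  have h : ∀ i, κ ⊔ invariantIdeal c J i = a ⊔ invariantIdeal c J i := fun i => by
    rw [← hκ, sup_assoc, sup_eq_right.2 (lcmPeriod_le c J i)]
  rw [card_ker_lTensor_phi c J ha, multiplicity]
  simp_rw [h]
  rw [eval_mul, eval_C, eval_pow, eval_X]
  push_cast
  ring

end Counting

/-! ### Comparison with the localization -/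

section BaseChange

variable {O : Type*} [CommRing O] (S : Submonoid O) {OS : Type*} [CommRing OS] [Algebra O OS]
  [IsLocalization S OS] {n ℓ : ℕ} (c : Fin n → Fin ℓ → O)

/-- The map over `OS` is the localization of the map over `O`; localization commutes with ranges and
preserves rank. -/
theorem rk_baseChange [IsDomain O] (hS : (0 : O) ∉ S) (J : Finset (Fin n)) :
    rk (baseChange OS c) J = rk c J := by
  let f : (Fin ℓ → O) →ₗ[O] (Fin ℓ → OS) :=
    LinearMap.pi fun i => Algebra.linearMap O OS ∘ₗ LinearMap.proj i
  let g : (J → O) →ₗ[O] (J → OS) :=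
    LinearMap.pi fun i => Algebra.linearMap O OS ∘ₗ LinearMap.proj i
  have hf : IsLocalizedModule S f := inferInstance
  have hg : IsLocalizedModule S g := inferInstance
  have hmap : IsLocalizedModule.map S f g (phi c J) =
      (phi (baseChange OS c) J).restrictScalars O := by
    refine IsLocalizedModule.linearMap_ext S f g ?_
    refine LinearMap.ext fun x => funext fun j => ?_
    rw [LinearMap.comp_apply, IsLocalizedModule.map_apply]
    exact RingHom.map_dotProduct (algebraMap O OS) x (c j)
  have h : (LinearMap.range (phi c J)).localized' OS S g =
      LinearMap.range (phi (baseChange OS c) J) := by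
    rw [LinearMap.localized'_range_eq_range_localizedMap OS S f g (phi c J), hmap]
    rfl
  rw [rk, rk, ← h, IsLocalization.finrank_eq OS S (le_nonZeroDivisors_of_zero_notMem hS)]
  exact IsLocalizedModule.finrank_eq S ((LinearMap.range (phi c J)).toLocalized' OS S g)
    (le_nonZeroDivisors_of_zero_notMem hS)

/-- The reduction isomorphism `(O/𝔞)^ℓ ≃ (O_S/𝔄)^ℓ`, where `𝔞` is the contraction of `𝔄`. -/
noncomputable def quotientPiEquiv [IsDomain O] [Ring.HasFiniteQuotients O] (ℓ : ℕ) {A : Ideal OS}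
    (hA : A ≠ ⊥) : (Fin ℓ → O ⧸ A.comap (algebraMap O OS)) ≃ (Fin ℓ → OS ⧸ A) :=
  Equiv.piCongrRight fun _ => Equiv.ofBijective _ (quotientMap_algebraMap_bijective S hA)

theorem quotientPiEquiv_mem_reducedHyperplane_iff [IsDomain O] [Ring.HasFiniteQuotients O]
    {A : Ideal OS} (hA : A ≠ ⊥) (j : Fin n) (y : Fin ℓ → O ⧸ A.comap (algebraMap O OS)) :
    quotientPiEquiv S ℓ hA y ∈ reducedHyperplane (baseChange OS c j) A ↔
      y ∈ reducedHyperplane (c j) (A.comap (algebraMap O OS)) := by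
  let e := Ideal.quotientMap A (algebraMap O OS) (le_refl (A.comap (algebraMap O OS)))
  have he : ∀ x : O, e (Ideal.Quotient.mk _ x) = Ideal.Quotient.mk A (algebraMap O OS x) :=
    fun _ => rfl
  rw [mem_reducedHyperplane_iff, mem_reducedHyperplane_iff,
    ← map_eq_zero_iff e (quotientMap_algebraMap_bijective S hA).1]
  refine Eq.congr_left ?_
  simp only [dotProduct, map_sum, map_mul, Function.comp_apply, he]
  rfl

include S in
theorem card_reducedHyperplane_baseChange [IsDomain O] [Ring.HasFiniteQuotients O]
    (J : Finset (Fin n)) {A : Ideal OS} (hA : A ≠ ⊥) :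
    Nat.card {y // ∀ j ∈ J, y ∈ reducedHyperplane (baseChange OS c j) A} =
      Nat.card {y // ∀ j ∈ J, y ∈ reducedHyperplane (c j) (A.comap (algebraMap O OS))} :=
  (Nat.card_congr ((quotientPiEquiv S ℓ hA).subtypeEquiv fun y => by
    simp only [quotientPiEquiv_mem_reducedHyperplane_iff])).symm

include S in
theorem charQuasi_baseChange [IsDomain O] [Ring.HasFiniteQuotients O] {A : Ideal OS} (hA : A ≠ ⊥) :
    charQuasi (baseChange OS c) A = charQuasi c (A.comap (algebraMap O OS)) := by
  rw [charQuasi, charQuasi, ← Nat.card_coe_set_eq, ← Nat.card_coe_set_eq]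
  refine congrArg _ (Nat.card_congr ((quotientPiEquiv S ℓ hA).subtypeEquiv fun y => ?_)).symm
  simp only [complement, Set.mem_compl_iff, Set.mem_iUnion,
    quotientPiEquiv_mem_reducedHyperplane_iff]

variable [IsDedekindDomain O] [Ring.HasFiniteQuotients O]

include S in
-- Both sides arise from the same number of solutions after cancelling the same power of `N(A)`.
theorem prod_idealNorm_sup_invariantIdeal_baseChange (hS : (0 : O) ∉ S) (J : Finset (Fin n))
    {A : Ideal OS} (hA : A ≠ ⊥) :
    ∏ i, idealNorm (A ⊔ invariantIdeal (baseChange OS c) J i) =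
      ∏ i, idealNorm (A.comap (algebraMap O OS) ⊔ invariantIdeal c J i) := by
  have := isDedekindDomain_of_isLocalization hS OS
  have := hasFiniteQuotients_of_isLocalization S OS
  have h := card_ker_lTensor_phi (baseChange OS c) J hA
  have h' := card_ker_lTensor_phi c J (comap_ne_bot S hA)
  rw [card_ker_lTensor_phi_eq] at h h'
  have hpow : idealNorm A ^ (ℓ - rk (baseChange OS c) J) = idealNorm A ^ (ℓ - rk c J) := by
    rw [rk_baseChange S c hS]
  rw [← card_reducedHyperplane_baseChange S c J hA, h, hpow, idealNorm_comap S hA] at h'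
  exact mul_left_cancel₀ (pow_ne_zero _ (idealNorm_ne_zero hA)) h'

/-- The extended ideals form a chain of nonzero ideals with the right norm products, so uniqueness
applies; the torsion modules themselves need not be compared. -/
theorem invariantIdeal_baseChange (hS : (0 : O) ∉ S) (J : Finset (Fin n))
    (i : Fin (rk (baseChange OS c) J)) :
    invariantIdeal (baseChange OS c) J i =
      (invariantIdeal c J (i.cast (rk_baseChange S c hS J))).map (algebraMap O OS) := by
  have := isDedekindDomain_of_isLocalization hS OS
  have := hasFiniteQuotients_of_isLocalization S OS
  have hD := isInvariantIdeals_invariantIdeal (baseChange OS c) J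
  have hd := isInvariantIdeals_invariantIdeal c J
  refine congrFun (eq_of_forall_prod_idealNorm_sup
    (d' := fun i => (invariantIdeal c J (i.cast (rk_baseChange S c hS J))).map (algebraMap O OS))
    hD.1 (fun i h => hd.1 (i.cast (rk_baseChange S c hS J)) ?_) hD.2.1
    (fun i j hij => ?_) fun A hA => ?_) i
  · exact (Ideal.map_eq_bot_iff_of_injective (IsLocalization.injective OS
      (le_nonZeroDivisors_of_zero_notMem hS))).1 h
  · exact Ideal.dvd_iff_le.2 (Ideal.map_mono (Ideal.dvd_iff_le.1 (hd.2.1 _ _ hij)))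
  · rw [prod_idealNorm_sup_invariantIdeal_baseChange S c hS J hA]
    simp_rw [idealNorm_sup_map S hA]
    exact (Fintype.prod_equiv (finCongr (rk_baseChange (OS := OS) S c hS J)) _ _ fun _ => rfl).symm

theorem lastInvariantIdeal_baseChange (hS : (0 : O) ∉ S) (J : Finset (Fin n)) :
    lastInvariantIdeal (baseChange OS c) J =
      (lastInvariantIdeal c J).map (algebraMap O OS) := by
  have h := rk_baseChange (OS := OS) S c hS J
  by_cases h0 : 0 < rk c J
  · have h0' : 0 < rk (baseChange OS c) J := h ▸ h0
    rw [lastInvariantIdeal, lastInvariantIdeal, dif_pos h0, dif_pos h0',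
      invariantIdeal_baseChange S c hS]
    congr 2
    exact Fin.ext (congrArg (· - 1) h)
  · rw [lastInvariantIdeal, lastInvariantIdeal, dif_neg h0, dif_neg (h.symm ▸ h0), Ideal.map_top]

theorem lcmPeriod_baseChange (hS : (0 : O) ∉ S) :
    lcmPeriod (baseChange OS c) = (lcmPeriod c).map (algebraMap O OS) := by
  rw [lcmPeriod_eq_inf, lcmPeriod_eq_inf]
  -- Extension to a localization commutes with finite intersections, which is why the period is
  -- rewritten as a finite infimum.
  refine Eq.trans ?_ (Finset.apply_inf_eq_inf_comp (Ideal.map (algebraMap O OS))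
    (fun I J => IsLocalization.map_inf S OS I J) (Ideal.map_top _)).symm
  exact Finset.inf_congr rfl fun J _ => lastInvariantIdeal_baseChange S c hS J

theorem constituent_baseChange (hS : (0 : O) ∉ S) {δ : Ideal OS} (hδ : δ ≠ ⊥) :
    constituent (baseChange OS c) δ = constituent c (δ.comap (algebraMap O OS)) := by
  refine Finset.sum_congr rfl fun J _ => ?_
  rw [multiplicity, multiplicity, prod_idealNorm_sup_invariantIdeal_baseChange S c hS J hδ,
    rk_baseChange S c hS]

end BaseChange

end ReducedArrangement

theorem mainTheorem5 {O : Type*} [CommRing O] [IsDedekindDomain O] [Ring.HasFiniteQuotients O]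
    (S : Submonoid O) (hS : (0 : O) ∉ S)
    {OS : Type*} [CommRing OS] [Algebra O OS] [IsLocalization S OS]
    {n ℓ : ℕ} (c : Fin n → Fin ℓ → O) :
    (ReducedArrangement.lcmPeriod (ReducedArrangement.baseChange OS c) =
      (ReducedArrangement.lcmPeriod c).map (algebraMap O OS)) ∧
    (∀ 𝔄 : Ideal OS, 𝔄 ≠ ⊥ →
      ReducedArrangement.charQuasi (ReducedArrangement.baseChange OS c) 𝔄 =
        ReducedArrangement.charQuasi c (𝔄.comap (algebraMap O OS))) ∧
    (∀ δ : Ideal OS, δ ∣ ReducedArrangement.lcmPeriod (ReducedArrangement.baseChange OS c) →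
      ReducedArrangement.IsConstituent (ReducedArrangement.charQuasi c)
        (ReducedArrangement.lcmPeriod c) (δ.comap (algebraMap O OS))
        (ReducedArrangement.constituent c (δ.comap (algebraMap O OS))) ∧
      ReducedArrangement.IsConstituent
        (ReducedArrangement.charQuasi (ReducedArrangement.baseChange OS c))
        (ReducedArrangement.lcmPeriod (ReducedArrangement.baseChange OS c)) δ
        (ReducedArrangement.constituent (ReducedArrangement.baseChange OS c) δ) ∧
      ReducedArrangement.constituent (ReducedArrangement.baseChange OS c) δ =
        ReducedArrangement.constituent c (δ.comap (algebraMap O OS))) := by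
  have := ReducedArrangement.isDedekindDomain_of_isLocalization hS OS
  have := ReducedArrangement.hasFiniteQuotients_of_isLocalization S OS
  refine ⟨ReducedArrangement.lcmPeriod_baseChange S c hS,
    fun A hA => ReducedArrangement.charQuasi_baseChange S c hA, fun δ hδ => ?_⟩
  -- Divisibility of the nonzero period is used only to make `δ` nonzero, so that its residue ring
  -- is finite.
  have hδ0 : δ ≠ ⊥ := ne_zero_of_dvd_ne_zero (ReducedArrangement.lcmPeriod_ne_bot _) hδ
  exact ⟨ReducedArrangement.isConstituent_constituent c _,
    ReducedArrangement.isConstituent_constituent _ δ,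
    ReducedArrangement.constituent_baseChange S c hS hδ0⟩
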